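/- Let $\omega = (\sqrt5-1)/2$ and, for integers $k\ge 1$, let $$P_k(\omega)=\prod_{r=1}^{k}\lvert 2\sin(\pi r\omega)\rvert .$$ There are real constants $K_1\le 0<1\le K_2$, independent of $k$, such that $k^{K_1}\le P_k(\omega)$ for every integer $k\ge 1$ and $P_k(\omega)\le k^{K_2}$ for every integer $k\ge 2$. -/

import Mathlib

/-- Sudler's sine product `P_n(ω) = ∏_{r=1}^{n} |2 sin (π r ω)|`. -/
noncomputable def sudlerProduct (n : ℕ) (ω : ℝ) : ℝ :=
  ∏ r ∈ Finset.Icc 1 n, |2 * Real.sin (Real.pi * (r : ℝ) * ω)|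

/-- The golden rotation number `ω = (√5 - 1) / 2`, the fractional part of the golden mean. -/
noncomputable def goldenRotation : ℝ := (Real.sqrt 5 - 1) / 2

open MeasureTheory Set Filter Topology

/-! Let L be the logarithm of the double sine function with periods 1 and ω, given by an integral.
Its differences under shifts by ω and by 1 are -log|2 sin πx| and -log|2 sin(πx/ω)|. Walking from ω
to (N+1)ω - M inside (0, 1+ω), by N steps of +ω and M of -1, telescopes to log P_N(ω) - log P_M(1/ω)
= L((N+1)ω - M) - L(ω) (`log_sudlerProduct_reciprocity`). For the golden rotation 1/ω = 1+ω, so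
P_M(1/ω) = P_M(ω). If M is nearest to Nω, the right side is bounded uniformly, as L is bounded away
from 0 and 1+ω. Replacing N by M thus costs O(1) in log P and shrinks N geometrically, so |log P_N|
= O(1 + log N). -/

/-! ### Integrability and uniform bounds for the double sine kernel. -/

theorem sinh_le_self_mul_cosh {v : ℝ} (hv : 0 ≤ v) : Real.sinh v ≤ v * Real.cosh v := by
  have hd : ∀ x : ℝ, HasDerivAt (fun x => x * Real.cosh x - Real.sinh x) (x * Real.sinh x) x := by
    intro x
    have := ((hasDerivAt_id x).mul (Real.hasDerivAt_cosh x)).sub (Real.hasDerivAt_sinh x)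
    convert! this using 1
    simp
  have hm : MonotoneOn (fun x => x * Real.cosh x - Real.sinh x) (Ici 0) := by
    refine monotoneOn_of_deriv_nonneg (convex_Ici 0)
      (fun x _ => (hd x).continuousAt.continuousWithinAt)
      (fun x _ => (hd x).differentiableAt.differentiableWithinAt) ?_
    intro x hx
    rw [interior_Ici] at hx
    rw [(hd x).deriv]
    exact mul_nonneg (le_of_lt hx) (Real.sinh_nonneg_iff.2 (le_of_lt hx))
  have := hm (mem_Ici.2 le_rfl) (mem_Ici.2 hv) hv
  simp at this
  linarith

theorem sinh_le_self_mul_exp {v : ℝ} (hv : 0 ≤ v) :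
    Real.sinh v ≤ v * Real.exp (v ^ 2 / 2) :=
  (sinh_le_self_mul_cosh hv).trans (mul_le_mul_of_nonneg_left (Real.cosh_le_exp_half_sq v) hv)

theorem exp_sub_one_le_self_mul_exp (v : ℝ) : Real.exp v - 1 ≤ v * Real.exp v := by
  have h := Real.add_one_le_exp (-v)
  have h2 : Real.exp (-v) * Real.exp v = 1 := by rw [← Real.exp_add]; simp
  nlinarith [Real.exp_pos v]

theorem exp_mul_le_sinh {a t : ℝ} (ha : 0 < a) (ht : 1 ≤ t) :
    (1 - Real.exp (-(2 * a))) / 2 * Real.exp (a * t) ≤ Real.sinh (a * t) := by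
  rw [Real.sinh_eq]
  have : Real.exp (-(a * t)) ≤ Real.exp (-(2 * a)) * Real.exp (a * t) := by
    rw [← Real.exp_add]
    apply Real.exp_le_exp.2
    nlinarith
  linarith

/-- The integrand of the logarithm of the double sine function with periods `2a`, `2b`,
at the point `a + b - B`. -/
noncomputable def doubleSineKernel (a b B t : ℝ) : ℝ :=
  (Real.sinh (B * t) / (2 * Real.sinh (a * t) * Real.sinh (b * t)) - B / (2 * a * b * t)) / t

theorem doubleSineKernel_neg (a b B t : ℝ) :
    doubleSineKernel a b (-B) t = -doubleSineKernel a b B t := by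
  simp only [doubleSineKernel, neg_mul, Real.sinh_neg]
  ring

theorem doubleSineKernel_comm (a b B t : ℝ) :
    doubleSineKernel a b B t = doubleSineKernel b a B t := by
  simp only [doubleSineKernel]
  congr 3 <;> ring

theorem measurable_doubleSineKernel (a b B : ℝ) : Measurable (doubleSineKernel a b B) := by
  unfold doubleSineKernel
  fun_prop

theorem doubleSineKernel_le_of_nonneg {a b B t : ℝ} (ha : 0 < a) (hb : 0 < b) (hB : 0 ≤ B)
    (ht : 0 < t) (ht1 : t ≤ 1) :
    doubleSineKernel a b B t ≤ B / (2 * a * b) * (B ^ 2 / 2 * Real.exp (B ^ 2 / 2)) := by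
  have h1 : Real.sinh (B * t) / (2 * Real.sinh (a * t) * Real.sinh (b * t)) ≤
      (B * t * Real.exp ((B * t) ^ 2 / 2)) / (2 * (a * t) * (b * t)) := by
    have := Real.self_le_sinh_iff.2 (mul_pos ha ht).le
    have := Real.self_le_sinh_iff.2 (mul_pos hb ht).le
    have := sinh_le_self_mul_exp (mul_nonneg hB ht.le)
    gcongr
  have h2 : Real.exp ((B * t) ^ 2 / 2) - 1 ≤ (B * t) ^ 2 / 2 * Real.exp (B ^ 2 / 2) := by
    refine (exp_sub_one_le_self_mul_exp _).trans ?_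
    gcongr
    exact mul_le_of_le_one_right hB ht1
  unfold doubleSineKernel
  calc _ ≤ ((B * t * Real.exp ((B * t) ^ 2 / 2)) / (2 * (a * t) * (b * t)) -
          B / (2 * a * b * t)) / t := by gcongr
    _ = B / (2 * a * b) * ((Real.exp ((B * t) ^ 2 / 2) - 1) / t ^ 2) := by
        field_simp
    _ ≤ B / (2 * a * b) * (((B * t) ^ 2 / 2 * Real.exp (B ^ 2 / 2)) / t ^ 2) := by gcongr
    _ = _ := by field_simp

theorem le_doubleSineKernel_of_nonneg {a b B t : ℝ} (ha : 0 < a) (hb : 0 < b) (hB : 0 ≤ B)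
    (ht : 0 < t) :
    -(B / (2 * a * b) * ((a ^ 2 + b ^ 2) / 2)) ≤ doubleSineKernel a b B t := by
  have h1 : (B * t) / (2 * (a * t * Real.exp ((a * t) ^ 2 / 2)) *
      (b * t * Real.exp ((b * t) ^ 2 / 2))) ≤
      Real.sinh (B * t) / (2 * Real.sinh (a * t) * Real.sinh (b * t)) := by
    have := Real.self_le_sinh_iff.2 (mul_nonneg hB ht.le)
    have := sinh_le_self_mul_exp (mul_pos hb ht).le
    have := sinh_le_self_mul_exp (mul_pos ha ht).le
    have := Real.sinh_pos_iff.2 (mul_pos ha ht)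
    have := Real.sinh_pos_iff.2 (mul_pos hb ht)
    gcongr
  have h2 : -((a ^ 2 + b ^ 2) / 2 * t ^ 2) ≤ Real.exp (-((a ^ 2 + b ^ 2) / 2 * t ^ 2)) - 1 := by
    linarith [Real.add_one_le_exp (-((a ^ 2 + b ^ 2) / 2 * t ^ 2))]
  have h3 : Real.exp (-((a ^ 2 + b ^ 2) / 2 * t ^ 2)) =
      (Real.exp ((a * t) ^ 2 / 2) * Real.exp ((b * t) ^ 2 / 2))⁻¹ := by
    rw [← Real.exp_add, ← Real.exp_neg]
    congr 1
    ring
  have e1 := Real.exp_pos ((a * t) ^ 2 / 2)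
  have e2 := Real.exp_pos ((b * t) ^ 2 / 2)
  unfold doubleSineKernel
  calc _ = B / (2 * a * b) * (-((a ^ 2 + b ^ 2) / 2 * t ^ 2) / t ^ 2) := by field_simp
    _ ≤ B / (2 * a * b) * ((Real.exp (-((a ^ 2 + b ^ 2) / 2 * t ^ 2)) - 1) / t ^ 2) := by gcongr
    _ = ((B * t) / (2 * (a * t * Real.exp ((a * t) ^ 2 / 2)) *
      (b * t * Real.exp ((b * t) ^ 2 / 2))) - B / (2 * a * b * t)) / t := by
        rw [h3]
        field_simp
    _ ≤ _ := by gcongr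

theorem abs_doubleSineKernel_le_of_one_le {a b B C t : ℝ} (ha : 0 < a) (hb : 0 < b) (hB : 0 ≤ B)
    (hBC : B ≤ C) (ht : 1 ≤ t) :
    |doubleSineKernel a b B t| ≤
      1 / ((1 - Real.exp (-(2 * a))) * (1 - Real.exp (-(2 * b)))) * Real.exp (-(a + b - C) * t) +
        C / (a * b) * (1 + t ^ 2)⁻¹ := by
  have ht0 : 0 < t := by linarith
  have hC : 0 ≤ C := hB.trans hBC
  have ca : 0 < 1 - Real.exp (-(2 * a)) := by
    have : Real.exp (-(2 * a)) < 1 := Real.exp_zero ▸ Real.exp_lt_exp.2 (by linarith)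
    linarith
  have cb : 0 < 1 - Real.exp (-(2 * b)) := by
    have : Real.exp (-(2 * b)) < 1 := Real.exp_zero ▸ Real.exp_lt_exp.2 (by linarith)
    linarith
  have sa := exp_mul_le_sinh ha ht
  have sb := exp_mul_le_sinh hb ht
  have pa := Real.sinh_pos_iff.2 (mul_pos ha ht0)
  have pb := Real.sinh_pos_iff.2 (mul_pos hb ht0)
  have pB := Real.sinh_nonneg_iff.2 (mul_nonneg hB ht0.le)
  have hs : Real.sinh (B * t) ≤ Real.exp (C * t) / 2 := by
    have : Real.exp (B * t) ≤ Real.exp (C * t) := Real.exp_le_exp.2 (by gcongr)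
    rw [Real.sinh_eq]
    linarith [Real.exp_pos (-(B * t))]
  have h1 : Real.sinh (B * t) / (2 * Real.sinh (a * t) * Real.sinh (b * t)) ≤
      1 / ((1 - Real.exp (-(2 * a))) * (1 - Real.exp (-(2 * b)))) *
        Real.exp (-(a + b - C) * t) := by
    calc _ ≤ (Real.exp (C * t) / 2) / (2 * ((1 - Real.exp (-(2 * a))) / 2 * Real.exp (a * t)) *
          ((1 - Real.exp (-(2 * b))) / 2 * Real.exp (b * t))) := by gcongr
      _ = _ := by
        rw [show -(a + b - C) * t = C * t - a * t - b * t by ring, Real.exp_sub, Real.exp_sub]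
        field_simp
  have h2 : B / (2 * a * b * t) / t ≤ C / (a * b) * (1 + t ^ 2)⁻¹ := by
    calc _ = B / (a * b) * (2 * t ^ 2)⁻¹ := by field_simp
      _ ≤ _ := by
        gcongr
        nlinarith
  have h3 : Real.sinh (B * t) / (2 * Real.sinh (a * t) * Real.sinh (b * t)) / t ≤
      Real.sinh (B * t) / (2 * Real.sinh (a * t) * Real.sinh (b * t)) :=
    div_le_self (by positivity) ht
  have h4 : 0 ≤ Real.sinh (B * t) / (2 * Real.sinh (a * t) * Real.sinh (b * t)) / t := by
    positivity
  have h5 : 0 ≤ B / (2 * a * b * t) / t := by positivity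
  unfold doubleSineKernel
  rw [sub_div, abs_le]
  constructor <;> linarith

/-- Near 0 the subtracted term cancels the pole and leaves a bounded kernel; at infinity the sinh
quotient decays like exp(-(a+b-C)t). One majorant serves all |B| ≤ C, which makes the integral
uniformly bounded. -/
theorem exists_integrable_bound_doubleSineKernel {a b C : ℝ} (ha : 0 < a) (hb : 0 < b)
    (hC : C < a + b) :
    ∃ G : ℝ → ℝ, IntegrableOn G (Ioi 0) ∧
      ∀ B t : ℝ, |B| ≤ C → 0 < t → |doubleSineKernel a b B t| ≤ G t := by
  set D := 1 / ((1 - Real.exp (-(2 * a))) * (1 - Real.exp (-(2 * b))))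
  set E := C / (2 * a * b) * (C ^ 2 / 2 * Real.exp (C ^ 2 / 2)) +
    C / (2 * a * b) * ((a ^ 2 + b ^ 2) / 2)
  have hD : 0 ≤ D := by
    have h1 : Real.exp (-(2 * a)) < 1 := Real.exp_zero ▸ Real.exp_lt_exp.2 (by linarith)
    have h2 : Real.exp (-(2 * b)) < 1 := Real.exp_zero ▸ Real.exp_lt_exp.2 (by linarith)
    exact div_nonneg zero_le_one (mul_nonneg (by linarith) (by linarith))
  -- The factor 2E covers (0, 1], where (1 + t²)⁻¹ ≥ 1/2.
  refine ⟨fun t => D * Real.exp (-(a + b - C) * t) + (C / (a * b) + 2 * E) * (1 + t ^ 2)⁻¹,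
    ?_, ?_⟩
  · exact ((exp_neg_integrableOn_Ioi 0 (by linarith)).const_mul D).add
      (integrable_inv_one_add_sq.integrableOn.const_mul _)
  · intro B t hB ht
    have hC0 : 0 ≤ C := (abs_nonneg B).trans hB
    have hE : 0 ≤ E := by positivity
    have habs : |doubleSineKernel a b B t| = |doubleSineKernel a b |B| t| := by
      rcases abs_choice B with h | h <;> rw [h]
      rw [doubleSineKernel_neg, abs_neg]
    rw [habs]
    have hp : 0 ≤ D * Real.exp (-(a + b - C) * t) := by positivity
    rcases le_total t 1 with h1 | h1
    · have u := doubleSineKernel_le_of_nonneg ha hb (abs_nonneg B) ht h1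
      have l := le_doubleSineKernel_of_nonneg ha hb (abs_nonneg B) ht
      have u' : |B| / (2 * a * b) * (|B| ^ 2 / 2 * Real.exp (|B| ^ 2 / 2)) ≤
        C / (2 * a * b) * (C ^ 2 / 2 * Real.exp (C ^ 2 / 2)) := by gcongr
      have l' : |B| / (2 * a * b) * ((a ^ 2 + b ^ 2) / 2) ≤
        C / (2 * a * b) * ((a ^ 2 + b ^ 2) / 2) := by gcongr
      have p1 : 0 ≤ C / (2 * a * b) * (C ^ 2 / 2 * Real.exp (C ^ 2 / 2)) := by positivity
      have p2 : 0 ≤ C / (2 * a * b) * ((a ^ 2 + b ^ 2) / 2) := by positivity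
      have hle : |doubleSineKernel a b |B| t| ≤ E := by
        rw [abs_le]
        constructor <;> simp only [E] <;> linarith
      have hhalf : (1 : ℝ) / 2 ≤ (1 + t ^ 2)⁻¹ := by
        rw [one_div]
        apply inv_anti₀ (by positivity)
        nlinarith
      have : 2 * E * (1 / 2) ≤ 2 * E * (1 + t ^ 2)⁻¹ := by gcongr
      have : 0 ≤ C / (a * b) * (1 + t ^ 2)⁻¹ := by positivity
      simp only [add_mul]
      linarith
    · have := abs_doubleSineKernel_le_of_one_le ha hb (abs_nonneg B) hB h1
      have : 0 ≤ 2 * E * (1 + t ^ 2)⁻¹ := by positivity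
      simp only [add_mul]
      linarith

theorem integrableOn_doubleSineKernel {a b B : ℝ} (ha : 0 < a) (hb : 0 < b) (hB : |B| < a + b) :
    IntegrableOn (doubleSineKernel a b B) (Ioi 0) := by
  obtain ⟨G, hG, h⟩ := exists_integrable_bound_doubleSineKernel ha hb hB
  refine hG.mono' (measurable_doubleSineKernel a b B).aestronglyMeasurable ?_
  filter_upwards [ae_restrict_mem measurableSet_Ioi] with t ht
  exact h B t le_rfl ht

theorem exists_abs_integral_doubleSineKernel_le {a b C : ℝ} (ha : 0 < a) (hb : 0 < b)
    (hC : C < a + b) :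
    ∃ D : ℝ, ∀ B : ℝ, |B| ≤ C → |∫ t in Ioi 0, doubleSineKernel a b B t| ≤ D := by
  obtain ⟨G, hG, h⟩ := exists_integrable_bound_doubleSineKernel ha hb hC
  refine ⟨∫ t in Ioi 0, G t, fun B hB => ?_⟩
  rw [← Real.norm_eq_abs]
  refine norm_integral_le_of_norm_le hG ?_
  filter_upwards [ae_restrict_mem measurableSet_Ioi] with t ht
  exact h B t hB ht

/-! ### The cosine kernel and its integral. -/

/-- The integrand of the logarithm of `1 / (2 cos (π u / (2b)))`. -/
noncomputable def cosineKernel (b u t : ℝ) : ℝ :=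
  (Real.cosh (u * t) / Real.sinh (b * t) - 1 / (b * t)) / t

/-- sinh(Bt) - sinh((B-2a)t) = 2 cosh((B-a)t) sinh(at), so the factor sinh(at) cancels. This is the
source of both difference equations. -/
theorem doubleSineKernel_sub {a b t : ℝ} (B : ℝ) (ha : 0 < a) (hb : 0 < b) (ht : 0 < t) :
    doubleSineKernel a b B t - doubleSineKernel a b (B - 2 * a) t = cosineKernel b (B - a) t := by
  have pa := Real.sinh_pos_iff.2 (mul_pos ha ht)
  have pb := Real.sinh_pos_iff.2 (mul_pos hb ht)
  have e1 : Real.sinh (B * t) =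
      Real.sinh ((B - a) * t) * Real.cosh (a * t) + Real.cosh ((B - a) * t) * Real.sinh (a * t) := by
    rw [← Real.sinh_add]
    congr 1
    ring
  have e2 : Real.sinh ((B - 2 * a) * t) =
      Real.sinh ((B - a) * t) * Real.cosh (a * t) - Real.cosh ((B - a) * t) * Real.sinh (a * t) := by
    rw [← Real.sinh_sub]
    congr 1
    ring
  unfold doubleSineKernel cosineKernel
  rw [e1, e2]
  field_simp
  ring

theorem integral_doubleSineKernel_sub {a b B : ℝ} (ha : 0 < a) (hb : 0 < b)
    (hB : |B| < a + b) (hB' : |B - 2 * a| < a + b) :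
    (∫ t in Ioi 0, doubleSineKernel a b B t) - ∫ t in Ioi 0, doubleSineKernel a b (B - 2 * a) t =
      ∫ t in Ioi 0, cosineKernel b (B - a) t := by
  rw [← integral_sub (integrableOn_doubleSineKernel ha hb hB)
    (integrableOn_doubleSineKernel ha hb hB')]
  exact setIntegral_congr_fun measurableSet_Ioi fun t ht => doubleSineKernel_sub B ha hb ht

theorem integrableOn_cosineKernel {b u : ℝ} (hu : |u| < b) :
    IntegrableOn (cosineKernel b u) (Ioi 0) := by
  have hb : 0 < b := (abs_nonneg u).trans_lt hu
  rw [abs_lt] at hu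
  have h1 : |u + b| < b + b := abs_lt.2 ⟨by linarith, by linarith⟩
  have h2 : |u + b - 2 * b| < b + b := abs_lt.2 ⟨by linarith, by linarith⟩
  refine ((integrableOn_doubleSineKernel hb hb h1).sub
    (integrableOn_doubleSineKernel hb hb h2)).congr_fun (fun t ht => ?_) measurableSet_Ioi
  have := doubleSineKernel_sub (u + b) hb hb ht
  simpa using this

theorem integral_cosineKernel_eq_one {b : ℝ} (u : ℝ) (hb : 0 < b) :
    ∫ t in Ioi 0, cosineKernel b u t = ∫ t in Ioi 0, cosineKernel 1 (u / b) t := by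
  have h := integral_comp_mul_left_Ioi' (cosineKernel 1 (u / b)) 0 hb
  rw [mul_zero] at h
  rw [← h, smul_eq_mul, ← integral_const_mul]
  refine setIntegral_congr_fun measurableSet_Ioi fun t ht => ?_
  have ht : 0 < t := ht
  simp only [cosineKernel]
  rw [show u / b * (b * t) = u * t by field_simp]
  field_simp

/-- Duplication, sinh t = 2 sinh(t/2) cosh(t/2), combined with scaling; it fixes the additive
constant left open by `integral_cosineKernel_sub_zero`. -/
theorem integral_cosineKernel_half :
    2 * ∫ t in Ioi 0, cosineKernel 1 (1 / 2) t = ∫ t in Ioi 0, cosineKernel 1 0 t := by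
  have h := integral_cosineKernel_eq_one 0 (one_half_pos (α := ℝ))
  rw [zero_div] at h
  rw [← h, ← integral_const_mul]
  refine setIntegral_congr_fun measurableSet_Ioi fun t ht => ?_
  have ht : 0 < t := ht
  have p := Real.sinh_pos_iff.2 (mul_pos (one_half_pos (α := ℝ)) ht)
  have c := Real.cosh_pos (1 / 2 * t)
  simp only [cosineKernel]
  rw [show 1 * t = 2 * (1 / 2 * t) by ring, Real.sinh_two_mul, zero_mul, Real.cosh_zero]
  field_simp

theorem prod_range_two_mul_euler (u : ℝ) (n : ℕ) :
    ∏ j ∈ Finset.range (2 * n), (1 - u ^ 2 / ((j : ℝ) + 1) ^ 2) =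
      (∏ k ∈ Finset.range n, (1 - u ^ 2 / (2 * (k : ℝ) + 1) ^ 2)) *
        ∏ k ∈ Finset.range n, (1 - (u / 2) ^ 2 / ((k : ℝ) + 1) ^ 2) := by
  induction n with
  | zero => simp
  | succ n ih =>
    rw [show 2 * (n + 1) = 2 * n + 1 + 1 by ring, Finset.prod_range_succ, Finset.prod_range_succ,
      ih, Finset.prod_range_succ, Finset.prod_range_succ]
    have : u ^ 2 / (((2 * n + 1 : ℕ) : ℝ) + 1) ^ 2 = (u / 2) ^ 2 / ((n : ℝ) + 1) ^ 2 := by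
      push_cast
      field_simp
      ring
    rw [this]
    push_cast
    ring

/-- Dividing Euler's product for sin πu by that for sin(πu/2) leaves the odd factors. -/
theorem tendsto_prod_cos {u : ℝ} (hu : |u| < 1) :
    Tendsto (fun n : ℕ => ∏ k ∈ Finset.range n, (1 - u ^ 2 / (2 * (k : ℝ) + 1) ^ 2)) atTop
      (𝓝 (Real.cos (Real.pi * u / 2))) := by
  rcases eq_or_ne u 0 with rfl | h0
  · simp
  have hu' := abs_lt.1 hu
  have hsin : Real.sin (Real.pi * (u / 2)) ≠ 0 := by
    rcases lt_or_gt_of_ne h0 with h | h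
    · refine (Real.sin_neg_of_neg_of_neg_pi_lt ?_ ?_).ne <;> nlinarith [Real.pi_pos]
    · refine (Real.sin_pos_of_pos_of_lt_pi ?_ ?_).ne' <;> nlinarith [Real.pi_pos]
  have hD : ∀ n : ℕ, ∏ k ∈ Finset.range n, (1 - (u / 2) ^ 2 / ((k : ℝ) + 1) ^ 2) ≠ 0 := by
    intro n
    refine Finset.prod_ne_zero_iff.2 fun k _ => ne_of_gt ?_
    have : (0 : ℝ) ≤ k := k.cast_nonneg
    rw [sub_pos, div_lt_one (by positivity)]
    nlinarith
  have h1 := (Real.tendsto_euler_sin_prod u).comp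
    (tendsto_id.const_mul_atTop' (two_pos : 0 < 2))
  have h2 := (Real.tendsto_euler_sin_prod (u / 2)).const_mul 2
  have h3 := h1.div h2 (mul_ne_zero two_ne_zero hsin)
  have e : Real.sin (Real.pi * u) / (2 * Real.sin (Real.pi * (u / 2))) =
      Real.cos (Real.pi * u / 2) := by
    rw [show Real.pi * u = 2 * (Real.pi * (u / 2)) by ring, Real.sin_two_mul,
      mul_div_cancel_left₀ _ (mul_ne_zero two_ne_zero hsin)]
    congr 1
    ring
  rw [e] at h3
  refine h3.congr fun n => ?_
  have hp := Real.pi_ne_zero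
  simp only [Pi.div_apply, Function.comp_apply, id]
  rw [prod_range_two_mul_euler, show 2 * (Real.pi * (u / 2) *
    ∏ k ∈ Finset.range n, (1 - (u / 2) ^ 2 / ((k : ℝ) + 1) ^ 2)) = Real.pi * u *
    ∏ k ∈ Finset.range n, (1 - (u / 2) ^ 2 / ((k : ℝ) + 1) ^ 2) by ring]
  rw [div_eq_iff (mul_ne_zero (mul_ne_zero hp h0) (hD n))]
  ring

theorem integral_frullani_exp {a b : ℝ} (ha : 0 < a) (hb : 0 < b) :
    IntegrableOn (fun t => t⁻¹ * (Real.exp (-(a * t)) - Real.exp (-(b * t)))) (Ioi 0) ∧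
    ∫ t in Ioi 0, t⁻¹ * (Real.exp (-(a * t)) - Real.exp (-(b * t))) = Real.log (b / a) := by
  have key : ∀ {a b : ℝ}, 0 < a → a ≤ b →
      IntegrableOn (fun t => t⁻¹ * (Real.exp (-(a * t)) - Real.exp (-(b * t)))) (Ioi 0) := by
    intro a b ha hab
    refine ((exp_neg_integrableOn_Ioi 0 ha).const_mul (b - a)).mono'
      (by fun_prop) ?_
    filter_upwards [ae_restrict_mem measurableSet_Ioi] with t ht
    have ht : 0 < t := ht
    have h1 : Real.exp (-(b * t)) ≤ Real.exp (-(a * t)) := Real.exp_le_exp.2 (by nlinarith)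
    have h2 : Real.exp (-(b * t)) = Real.exp (-(a * t)) * Real.exp (-((b - a) * t)) := by
      rw [← Real.exp_add]
      congr 1
      ring
    have h3 := Real.add_one_le_exp (-((b - a) * t))
    rw [Real.norm_of_nonneg (mul_nonneg (by positivity) (by linarith)), inv_mul_le_iff₀ ht, h2,
      neg_mul]
    nlinarith [Real.exp_pos (-(a * t))]
  have hint : IntegrableOn (fun t => t⁻¹ * (Real.exp (-(a * t)) - Real.exp (-(b * t)))) (Ioi 0) := by
    rcases le_total a b with h | h
    · exact key ha h
    · have := (key hb h).neg
      refine this.congr_fun (fun t _ => ?_) measurableSet_Ioi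
      simp only [Pi.neg_apply]
      ring
  refine ⟨hint, ?_⟩
  have hc : Continuous fun t : ℝ => Real.exp (-t) := by fun_prop
  have h0 : Tendsto (fun t : ℝ => Real.exp (-t)) (𝓝[>] 0) (𝓝 1) := by
    have := hc.tendsto 0
    simp only [neg_zero, Real.exp_zero] at this
    exact this.mono_left nhdsWithin_le_nhds
  have := Frullani.integral_Ioi_eq (f := fun t : ℝ => Real.exp (-t))
    (hc.locallyIntegrable.locallyIntegrableOn _) ha hb h0
    (Real.tendsto_exp_neg_atTop_nhds_zero) (by simpa using hint)
  simpa using this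

theorem hasSum_inv_sinh {t : ℝ} (ht : 0 < t) :
    HasSum (fun n : ℕ => 2 * Real.exp (-((2 * n + 1) * t))) (1 / Real.sinh t) := by
  have hr : Real.exp (-(2 * t)) < 1 := Real.exp_zero ▸ Real.exp_lt_exp.2 (by linarith)
  have h := (hasSum_geometric_of_lt_one (Real.exp_pos _).le hr).mul_left (2 * Real.exp (-t))
  convert! h using 1
  · ext n
    rw [← Real.exp_nat_mul, mul_assoc, ← Real.exp_add]
    congr 2
    ring
  · have h2 : Real.exp (-(2 * t)) = Real.exp (-t) * Real.exp (-t) := by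
      rw [← Real.exp_add]
      congr 1
      ring
    have h3 : Real.exp t * Real.exp (-t) = 1 := by rw [← Real.exp_add]; simp
    have p := Real.sinh_pos_iff.2 ht
    have q : 0 < 1 - Real.exp (-(2 * t)) := by linarith
    rw [← div_eq_mul_inv, div_eq_div_iff p.ne' q.ne', h2, Real.sinh_eq]
    linear_combination -h3

/-- Expand 1/sinh t geometrically; each term is a pair of Frullani integrals giving minus the
logarithm of one factor of the cosine product. -/
theorem integral_cosineKernel_sub_zero {u : ℝ} (hu : |u| < 1) :
    (∫ t in Ioi 0, cosineKernel 1 u t) - ∫ t in Ioi 0, cosineKernel 1 0 t =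
      -Real.log (Real.cos (Real.pi * u / 2)) := by
  -- Pairing ±u makes each term nonnegative, so the series dominates itself.
  set F : ℕ → ℝ → ℝ := fun n t =>
    t⁻¹ * (Real.exp (-((2 * n + 1 - u) * t)) - Real.exp (-((2 * n + 1) * t))) +
      t⁻¹ * (Real.exp (-((2 * n + 1 + u) * t)) - Real.exp (-((2 * n + 1) * t))) with hF
  have hu' := abs_lt.1 hu
  have hp : ∀ n : ℕ, (0 : ℝ) < 2 * n + 1 ∧ (0 : ℝ) < 2 * n + 1 - u ∧ (0 : ℝ) < 2 * n + 1 + u := by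
    intro n
    have : (0 : ℝ) ≤ n := n.cast_nonneg
    exact ⟨by linarith, by linarith, by linarith⟩
  have hFe : ∀ n t, F n t =
      (Real.cosh (u * t) - 1) / t * (2 * Real.exp (-((2 * n + 1) * t))) := by
    intro n t
    have e1 : Real.exp (-((2 * n + 1 - u) * t)) =
        Real.exp (u * t) * Real.exp (-((2 * n + 1) * t)) := by
      rw [← Real.exp_add]; congr 1; ring
    have e2 : Real.exp (-((2 * n + 1 + u) * t)) =
        Real.exp (-(u * t)) * Real.exp (-((2 * n + 1) * t)) := by
      rw [← Real.exp_add]; congr 1; ring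
    simp only [hF, e1, e2, Real.cosh_eq]
    ring
  have hint : IntegrableOn (fun t => cosineKernel 1 u t - cosineKernel 1 0 t) (Ioi 0) :=
    (integrableOn_cosineKernel hu).sub (integrableOn_cosineKernel (by simp))
  have hsum : ∀ t ∈ Ioi (0 : ℝ), HasSum (fun n => F n t) (cosineKernel 1 u t - cosineKernel 1 0 t) := by
    intro t ht
    simp only [hFe]
    convert! (hasSum_inv_sinh ht).mul_left ((Real.cosh (u * t) - 1) / t) using 1
    simp only [cosineKernel, one_mul, zero_mul, Real.cosh_zero]
    ring
  have hnn : ∀ n, ∀ t ∈ Ioi (0 : ℝ), 0 ≤ F n t := by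
    intro n t ht
    have ht : 0 < t := ht
    rw [hFe]
    have := Real.one_le_cosh (u * t)
    exact mul_nonneg (div_nonneg (by linarith) ht.le) (by positivity)
  have hI : HasSum (fun n => ∫ t in Ioi 0, F n t)
      (∫ t in Ioi 0, (cosineKernel 1 u t - cosineKernel 1 0 t)) := by
    refine hasSum_integral_of_dominated_convergence F (fun n => ?_) (fun n => ?_) ?_ ?_ ?_
    · simp only [hF]
      fun_prop
    · filter_upwards [ae_restrict_mem measurableSet_Ioi] with t ht
      rw [Real.norm_of_nonneg (hnn n t ht)]
    · filter_upwards [ae_restrict_mem measurableSet_Ioi] with t ht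
      exact (hsum t ht).summable
    · refine hint.congr ?_
      filter_upwards [ae_restrict_mem measurableSet_Ioi] with t ht
      exact (hsum t ht).tsum_eq.symm
    · filter_upwards [ae_restrict_mem measurableSet_Ioi] with t ht
      exact hsum t ht
  have hval : ∀ n : ℕ, ∫ t in Ioi 0, F n t = -Real.log (1 - u ^ 2 / (2 * (n : ℝ) + 1) ^ 2) := by
    intro n
    obtain ⟨h0, h1, h2⟩ := hp n
    have f1 := integral_frullani_exp h1 h0
    have f2 := integral_frullani_exp h2 h0
    simp only [hF]
    rw [integral_add f1.1 f2.1, f1.2, f2.2, ← Real.log_mul (by positivity) (by positivity),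
      ← Real.log_inv]
    congr 1
    have : 1 - u ^ 2 / (2 * (n : ℝ) + 1) ^ 2 =
        (2 * n + 1 - u) * (2 * n + 1 + u) / (2 * (n : ℝ) + 1) ^ 2 := by
      field_simp
      ring
    rw [this]
    field_simp
  have hfac : ∀ n : ℕ, 0 < 1 - u ^ 2 / (2 * (n : ℝ) + 1) ^ 2 := by
    intro n
    obtain ⟨h0, h1, h2⟩ := hp n
    rw [sub_pos, div_lt_one (by positivity)]
    nlinarith
  have hcos : 0 < Real.cos (Real.pi * u / 2) := by
    apply Real.cos_pos_of_mem_Ioo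
    constructor <;> nlinarith [Real.pi_pos]
  have hlim : Tendsto (fun n : ℕ => ∑ k ∈ Finset.range n, ∫ t in Ioi 0, F k t) atTop
      (𝓝 (-Real.log (Real.cos (Real.pi * u / 2)))) := by
    have := ((Real.continuousAt_log hcos.ne').tendsto.comp (tendsto_prod_cos hu)).neg
    refine this.congr fun n => ?_
    simp only [Function.comp_apply, hval, Finset.sum_neg_distrib]
    rw [Real.log_prod fun k _ => (hfac k).ne']
  rw [← integral_sub (integrableOn_cosineKernel hu) (integrableOn_cosineKernel (by simp))]
  exact tendsto_nhds_unique hI.tendsto_sum_nat hlim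

theorem integral_cosineKernel {u : ℝ} (hu : |u| < 1) :
    ∫ t in Ioi 0, cosineKernel 1 u t = -Real.log (2 * Real.cos (Real.pi * u / 2)) := by
  have hcos : 0 < Real.cos (Real.pi * u / 2) := by
    have hu' := abs_lt.1 hu
    apply Real.cos_pos_of_mem_Ioo
    constructor <;> nlinarith [Real.pi_pos]
  have h1 := integral_cosineKernel_sub_zero hu
  have h2 := integral_cosineKernel_sub_zero (u := 1 / 2) (by rw [abs_of_pos] <;> norm_num)
  rw [show Real.pi * (1 / 2) / 2 = Real.pi / 4 by ring, Real.cos_pi_div_four,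
    Real.log_div (by positivity) two_ne_zero, Real.log_sqrt zero_le_two] at h2
  have h3 := integral_cosineKernel_half
  rw [Real.log_mul two_ne_zero hcos.ne']
  linarith

/-! ### The double sine function and its two difference equations. -/

/-- The logarithm of the double sine function with periods `1` and `ω`, up to sign. -/
noncomputable def logDoubleSine (ω x : ℝ) : ℝ :=
  ∫ t in Ioi 0, doubleSineKernel ω 1 (1 + ω - 2 * x) t

theorem logDoubleSine_sub_add_period {ω x : ℝ} (hω : 0 < ω) (hx : 0 < x) (hx1 : x < 1) :
    logDoubleSine ω x - logDoubleSine ω (x + ω) = -Real.log |2 * Real.sin (Real.pi * x)| := by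
  have h := integral_doubleSineKernel_sub (B := 1 + ω - 2 * x) hω one_pos
    (abs_lt.2 ⟨by linarith, by linarith⟩) (abs_lt.2 ⟨by linarith, by linarith⟩)
  rw [integral_cosineKernel (abs_lt.2 ⟨by linarith, by linarith⟩)] at h
  rw [logDoubleSine, logDoubleSine, Real.log_abs,
    show 1 + ω - 2 * (x + ω) = 1 + ω - 2 * x - 2 * ω by ring,
    h, ← Real.cos_pi_div_two_sub]
  congr 4
  ring

theorem logDoubleSine_sub_add_one {ω x : ℝ} (hx : 0 < x) (hxω : x < ω) :
    logDoubleSine ω x - logDoubleSine ω (x + 1) =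
      -Real.log |2 * Real.sin (Real.pi * (x / ω))| := by
  have hω : 0 < ω := hx.trans hxω
  have h := integral_doubleSineKernel_sub (a := 1) (b := ω) (B := 1 + ω - 2 * x) one_pos hω
    (abs_lt.2 ⟨by linarith, by linarith⟩) (abs_lt.2 ⟨by linarith, by linarith⟩)
  rw [integral_cosineKernel_eq_one _ hω, integral_cosineKernel (by
    rw [abs_div, abs_of_pos hω, div_lt_one hω]
    exact abs_lt.2 ⟨by linarith, by linarith⟩)] at h
  simp only [doubleSineKernel_comm 1 ω] at h
  rw [logDoubleSine, logDoubleSine, Real.log_abs,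
    show 1 + ω - 2 * (x + 1) = 1 + ω - 2 * x - 2 * 1 by ring,
    h, ← Real.cos_pi_div_two_sub]
  congr 4
  field_simp
  ring

theorem exists_abs_logDoubleSine_le {ω δ : ℝ} (hω : 0 < ω) (hδ : 0 < δ) :
    ∃ D : ℝ, ∀ x : ℝ, δ ≤ x → x ≤ 1 + ω - δ → |logDoubleSine ω x| ≤ D := by
  obtain ⟨D, hD⟩ := exists_abs_integral_doubleSineKernel_le (C := 1 + ω - 2 * δ) hω one_pos
    (by linarith)
  exact ⟨D, fun x h1 h2 => hD _ (abs_le.2 ⟨by linarith, by linarith⟩)⟩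

/-! ### Sudler products and reciprocity. -/

theorem abs_sin_add_int_mul_pi (x : ℝ) (n : ℤ) : |Real.sin (x + n * Real.pi)| = |Real.sin x| := by
  rw [Real.sin_add_int_mul_pi, abs_mul, abs_zpow]
  simp

theorem sudlerProduct_succ (n : ℕ) (ω : ℝ) :
    sudlerProduct (n + 1) ω =
      sudlerProduct n ω * |2 * Real.sin (Real.pi * ((n : ℝ) + 1) * ω)| := by
  rw [sudlerProduct, Finset.prod_Icc_succ_top (by omega), ← sudlerProduct]
  push_cast
  rfl

theorem sin_pi_natCast_mul_ne_zero {ω : ℝ} (hω : Irrational ω) {r : ℕ} (hr : r ≠ 0) :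
    Real.sin (Real.pi * r * ω) ≠ 0 := by
  intro h
  obtain ⟨n, hn⟩ := Real.sin_eq_zero_iff.1 h
  refine (hω.natCast_mul hr).ne_int n ?_
  have := Real.pi_ne_zero
  apply mul_left_cancel₀ this
  linarith

theorem sudlerProduct_pos {ω : ℝ} (hω : Irrational ω) (n : ℕ) : 0 < sudlerProduct n ω := by
  refine Finset.prod_pos fun r hr => abs_pos.2 (mul_ne_zero two_ne_zero ?_)
  exact sin_pi_natCast_mul_ne_zero hω (by have := Finset.mem_Icc.1 hr; omega)

theorem log_sudlerProduct_succ {ω : ℝ} (hω : Irrational ω) (n : ℕ) :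
    Real.log (sudlerProduct (n + 1) ω) =
      Real.log (sudlerProduct n ω) + Real.log |2 * Real.sin (Real.pi * ((n : ℝ) + 1) * ω)| := by
  rw [sudlerProduct_succ, Real.log_mul (sudlerProduct_pos hω n).ne']
  have := sin_pi_natCast_mul_ne_zero hω n.succ_ne_zero
  push_cast at this
  exact abs_ne_zero.2 (mul_ne_zero two_ne_zero this)

/-- Reciprocity between the Sudler products at `ω` and at `1 / ω`. -/
theorem log_sudlerProduct_reciprocity {ω : ℝ} (hirr : Irrational ω) (hω : 0 < ω) :
    ∀ s N M : ℕ, N + M = s → 0 < ((N : ℝ) + 1) * ω - M → ((N : ℝ) + 1) * ω - M < 1 + ω →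
      Real.log (sudlerProduct N ω) - logDoubleSine ω (((N : ℝ) + 1) * ω - M) =
        Real.log (sudlerProduct M ω⁻¹) - logDoubleSine ω ω := by
  intro s
  induction s with
  | zero =>
    intro N M h _ _
    obtain ⟨rfl, rfl⟩ : N = 0 ∧ M = 0 := by omega
    simp [sudlerProduct]
  | succ s ih =>
    intro N M h h0 h1
    -- The last step of the walk is +ω if the endpoint exceeds ω, and -1 if it is below ω; either
    -- way the previous point lies in (0, 1+ω). Equality would force Nω = M.
    rcases lt_or_ge ω (((N : ℝ) + 1) * ω - M) with hlt | hle
    · obtain _ | n := N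
      · have : (0 : ℝ) ≤ M := M.cast_nonneg
        push_cast at hlt
        linarith
      push_cast at hlt h0 h1 ⊢
      have e := ih n M (by omega) (by linarith) (by linarith)
      have f := logDoubleSine_sub_add_period (x := ((n : ℝ) + 1) * ω - M) hω (by linarith)
        (by linarith)
      have g : |2 * Real.sin (Real.pi * (((n : ℝ) + 1) * ω - M))| =
          |2 * Real.sin (Real.pi * ((n : ℝ) + 1) * ω)| := by
        rw [abs_mul, abs_mul, ← abs_sin_add_int_mul_pi _ M]
        congr 3
        push_cast
        ring
      rw [g] at f
      rw [log_sudlerProduct_succ hirr]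
      rw [show ((n : ℝ) + 1) * ω - M + ω = ((n : ℝ) + 1 + 1) * ω - M by ring] at f
      linarith
    · have hne : (N : ℝ) * ω ≠ M := by
        rcases Nat.eq_zero_or_pos N with rfl | hN
        · have : M ≠ 0 := by omega
          simpa [eq_comm] using this
        · exact (hirr.natCast_mul hN.ne').ne_nat M
      have hlt : ((N : ℝ) + 1) * ω - M < ω := by
        refine lt_of_le_of_ne hle fun h => hne ?_
        linarith
      obtain _ | m := M
      · have : (0 : ℝ) ≤ N * ω := by positivity
        push_cast at hlt
        linarith
      push_cast at hlt h0 h1 ⊢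
      have e := ih N m (by omega) (by linarith) (by linarith)
      have f := logDoubleSine_sub_add_one (x := ((N : ℝ) + 1) * ω - (m + 1)) (by linarith) hlt
      have g : |2 * Real.sin (Real.pi * ((((N : ℝ) + 1) * ω - (m + 1)) / ω))| =
          |2 * Real.sin (Real.pi * ((m : ℝ) + 1) * ω⁻¹)| := by
        rw [abs_mul, abs_mul, ← abs_sin_add_int_mul_pi _ (-(N + 1)),
          ← abs_neg (Real.sin (_ + _)), ← Real.sin_neg]
        congr 3
        push_cast
        field_simp
        ring
      rw [g] at f
      rw [log_sudlerProduct_succ hirr.inv]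
      rw [show ((N : ℝ) + 1) * ω - (m + 1) + 1 = ((N : ℝ) + 1) * ω - m by ring] at f
      linarith

theorem sudlerProduct_add_one (n : ℕ) (ω : ℝ) : sudlerProduct n (1 + ω) = sudlerProduct n ω := by
  refine Finset.prod_congr rfl fun r _ => ?_
  rw [abs_mul, abs_mul, ← abs_sin_add_int_mul_pi (Real.pi * r * ω) r]
  congr 3
  push_cast
  ring

/-! ### The golden rotation and the descent on N. -/

theorem goldenRotation_eq : goldenRotation = -Real.goldenConj := by
  rw [goldenRotation, Real.goldenConj]
  ring

theorem irrational_goldenRotation : Irrational goldenRotation := by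
  rw [goldenRotation_eq]
  exact Real.goldenConj_irrational.neg

theorem half_lt_goldenRotation : 1 / 2 < goldenRotation := by
  have : 2 < Real.sqrt 5 := Real.lt_sqrt_of_sq_lt (by norm_num)
  rw [goldenRotation]
  linarith

theorem goldenRotation_lt : goldenRotation < 5 / 8 := by
  have : Real.sqrt 5 < 9 / 4 := (Real.sqrt_lt' (by norm_num)).2 (by norm_num)
  rw [goldenRotation]
  linarith

theorem inv_goldenRotation : goldenRotation⁻¹ = 1 + goldenRotation := by
  have h := half_lt_goldenRotation
  have h5 := Real.sq_sqrt (show (0 : ℝ) ≤ 5 by norm_num)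
  rw [inv_eq_iff_eq_inv, ← one_div, eq_div_iff (by linarith), goldenRotation]
  linarith

theorem exists_abs_log_sudlerProduct_sub_le :
    ∃ D : ℝ, ∀ N M : ℕ, |(N : ℝ) * goldenRotation - M| ≤ 1 / 2 →
      |Real.log (sudlerProduct N goldenRotation) - Real.log (sudlerProduct M goldenRotation)| ≤
        D := by
  have h1 := half_lt_goldenRotation
  have h2 := goldenRotation_lt
  -- The endpoint is within 1/2 of ω, hence at least ω - 1/2 away from both 0 and 1 + ω.
  obtain ⟨D, hD⟩ := exists_abs_logDoubleSine_le (ω := goldenRotation)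
    (δ := goldenRotation - 1 / 2) (by linarith) (by linarith)
  refine ⟨D + D, fun N M h => ?_⟩
  rw [abs_le] at h
  have e := log_sudlerProduct_reciprocity irrational_goldenRotation (by linarith) _ N M rfl
    (by linarith) (by linarith)
  rw [inv_goldenRotation, sudlerProduct_add_one] at e
  have b1 := hD goldenRotation (by linarith) (by linarith)
  have b2 := hD (((N : ℝ) + 1) * goldenRotation - M) (by linarith) (by linarith)
  rw [abs_le] at *
  constructor <;> linarith

theorem exists_abs_log_sudlerProduct_le :
    ∃ D E : ℝ, 0 ≤ D ∧ 0 ≤ E ∧ ∀ N : ℕ, 1 ≤ N →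
      |Real.log (sudlerProduct N goldenRotation)| ≤ D + E * Real.log N := by
  have h1 := half_lt_goldenRotation
  have h2 := goldenRotation_lt
  obtain ⟨D, hD⟩ := exists_abs_log_sudlerProduct_sub_le
  have hD0 : 0 ≤ D := (abs_nonneg _).trans (hD 0 0 (by norm_num))
  have hl : 0 < Real.log (8 / 7) := Real.log_pos (by norm_num)
  set A := D + |Real.log (sudlerProduct 1 goldenRotation)|
  have hA : D ≤ A := le_add_of_nonneg_right (abs_nonneg _)
  have hA0 : 0 ≤ A := hD0.trans hA
  -- Each descent step costs at most A and lowers log N by at least log(8/7).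
  refine ⟨A, A / Real.log (8 / 7), hA0, by positivity, fun N => ?_⟩
  induction N using Nat.strong_induction_on with
  | _ N ih =>
    intro hN
    rcases hN.eq_or_lt with rfl | hN
    · simp [A, hD0]
    have hN2 : (2 : ℝ) ≤ N := by exact_mod_cast hN
    set M := ⌊(N : ℝ) * goldenRotation + 1 / 2⌋₊ with hM
    have hx : 0 ≤ (N : ℝ) * goldenRotation + 1 / 2 := by positivity
    have m1 : (M : ℝ) ≤ N * goldenRotation + 1 / 2 := Nat.floor_le hx
    have m2 : (N : ℝ) * goldenRotation + 1 / 2 < M + 1 := Nat.lt_floor_add_one _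
    have m3 : 1 ≤ M := Nat.le_floor (by push_cast; nlinarith)
    -- ω < 5/8, and 1/2 ≤ N/4 because N ≥ 2.
    have m4 : (M : ℝ) ≤ 7 / 8 * N := by nlinarith
    have m5 : M < N := by
      have : (M : ℝ) < N := by linarith
      exact_mod_cast this
    have a := hD N M (abs_le.2 ⟨by linarith, by linarith⟩)
    have b := ih M m5 m3
    have mp : (0 : ℝ) < M := by exact_mod_cast m3
    have c : Real.log M ≤ Real.log N - Real.log (8 / 7) := by
      rw [← Real.log_div (by positivity) (by norm_num)]
      refine Real.log_le_log mp ?_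
      linarith
    have d : A / Real.log (8 / 7) * Real.log M ≤ A / Real.log (8 / 7) * Real.log N - A := by
      calc _ ≤ A / Real.log (8 / 7) * (Real.log N - Real.log (8 / 7)) := by gcongr
        _ = _ := by field_simp
    have t := abs_sub_abs_le_abs_sub (Real.log (sudlerProduct N goldenRotation))
      (Real.log (sudlerProduct M goldenRotation))
    linarith

/-- Needed separately for k = 1, where every power of k equals 1 and cannot absorb a constant. -/
theorem one_le_sudlerProduct_one : 1 ≤ sudlerProduct 1 goldenRotation := by
  have h1 := half_lt_goldenRotation
  have h2 := goldenRotation_lt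
  have h : Real.sin (Real.pi / 6) ≤ Real.sin (Real.pi * (1 - goldenRotation)) := by
    apply Real.sin_le_sin_of_le_of_le_pi_div_two <;> nlinarith [Real.pi_pos]
  rw [Real.sin_pi_div_six, show Real.pi * (1 - goldenRotation) = Real.pi - Real.pi * goldenRotation
    by ring, Real.sin_pi_sub] at h
  simp only [sudlerProduct, Finset.Icc_self, Finset.prod_singleton, Nat.cast_one, mul_one]
  exact le_trans (by linarith) (le_abs_self _)

theorem mainTheorem2 :
    ∃ K₁ K₂ : ℝ, K₁ ≤ 0 ∧ 1 ≤ K₂ ∧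
      (∀ k : ℕ, 1 ≤ k → (k : ℝ) ^ K₁ ≤ sudlerProduct k goldenRotation) ∧
      (∀ k : ℕ, 2 ≤ k → sudlerProduct k goldenRotation ≤ (k : ℝ) ^ K₂) := by
  obtain ⟨D, E, hD, hE, h⟩ := exists_abs_log_sudlerProduct_le
  have hl : 0 < Real.log 2 := Real.log_pos one_lt_two
  -- For k ≥ 2 the constant D is absorbed using log k ≥ log 2.
  set K := D / Real.log 2 + E
  have hK : 0 ≤ K := by positivity
  have key : ∀ k : ℕ, 2 ≤ k →
      |Real.log (sudlerProduct k goldenRotation)| ≤ Real.log k * K := by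
    intro k hk
    have hk2 : Real.log 2 ≤ Real.log k := Real.log_le_log two_pos (by exact_mod_cast hk)
    have : D ≤ D / Real.log 2 * Real.log k := by
      calc D = D / Real.log 2 * Real.log 2 := by field_simp
        _ ≤ _ := by gcongr
    have := h k (by omega)
    simp only [K]
    linarith
  refine ⟨-K, K + 1, by linarith, by linarith, fun k hk => ?_, fun k hk => ?_⟩
  · rcases hk.eq_or_lt with rfl | hk
    · simpa using one_le_sudlerProduct_one
    have hk0 : (0 : ℝ) < k := by positivity
    rw [Real.rpow_def_of_pos hk0,
      ← Real.le_log_iff_exp_le (sudlerProduct_pos irrational_goldenRotation k)]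
    linarith [(abs_le.1 (key k hk)).1]
  · have hk0 : (0 : ℝ) < k := by positivity
    have hlk : 0 ≤ Real.log k := Real.log_natCast_nonneg k
    rw [Real.rpow_def_of_pos hk0,
      ← Real.log_le_iff_le_exp (sudlerProduct_pos irrational_goldenRotation k)]
    linarith [(abs_le.1 (key k hk)).2]
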